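/- Let $\mathbb{K}=\mathbb{R}$ or $\mathbb{K}=\mathbb{C}$. Let $C([0,\omega_1])$ be the Banach space of continuous $\mathbb{K}$-valued functions on the ordinal interval $[0,\omega_1]$ (with the order topology), where $\omega_1$ is the first uncountable ordinal, equipped with the supremum norm, and let $\mathscr{B}(C([0,\omega_1]))$ be the Banach algebra of bounded linear operators on it. For a set $\Gamma$, let $c_0(\Gamma)$ be the Banach space of functions $f\colon\Gamma\to\mathbb{K}$ such that $\{\gamma\in\Gamma : |f(\gamma)|\ge\varepsilon\}$ is finite for every $\varepsilon>0$, with pointwise operations and the supremum norm; write $c_0=c_0(\mathbb{N})$ and $c_0(\omega_1)=c_0([0,\omega_1))$. For Banach spaces $X$ and $Z$, let $\overline{\mathscr{G}}_Z(X)$ be the operator-norm closure in $\mathscr{B}(X)$ of the linear span of $\{TS : S\in\mathscr{B}(X,Z),\ T\in\mathscr{B}(Z,X)\}$; it is a closed two-sided ideal of $\mathscr{B}(X)$. **Proposition.** No closed two-sided ideal of $\mathscr{B}(C([0,\omega_1]))$ lies strictly between $\overline{\mathscr{G}}_{c_0}(C([0,\omega_1]))$ and $\overline{\mathscr{G}}_{c_0(\omega_1)}(C([0,\omega_1]))$.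 -/

import Mathlib

open scoped Ordinal ENNReal

/-- The interval `[0, ω₁]` of ordinals, with the order topology. -/
abbrev OrdIccOmegaOne : Type 1 := Set.Icc (0 : Ordinal.{0}) ω₁

/-- The set `[0, ω₁)` of countable ordinals, used only as an index set (its topology is ignored). -/
abbrev CountableOrd : Type 1 := Set.Iio (ω₁ : Ordinal.{0})

/-- The Banach space `C([0, ω₁])` of continuous scalar-valued functions, with the supremum norm. -/
abbrev COmegaOne (𝕜 : Type*) [RCLike 𝕜] := C(OrdIccOmegaOne, 𝕜)

/-- The Banach space `c₀(Γ)` of scalar-valued functions `f` on a set `Γ` such that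
`{γ | ε ≤ |f γ|}` is finite for every `ε > 0`, with pointwise operations and the supremum norm,
realised as a subspace of `ℓ^∞(Γ)`. -/
def cZero (𝕜 : Type*) [RCLike 𝕜] (Γ : Type*) : Submodule 𝕜 (lp (fun _ : Γ => 𝕜) ∞) where
  carrier := {f | ∀ ε : ℝ, 0 < ε → {γ : Γ | ε ≤ ‖f γ‖}.Finite}
  zero_mem' := by
    intro ε hε
    convert Set.finite_empty using 1
    ext γ
    simp [hε]
  add_mem' := by
    intro f g hf hg ε hε
    refine ((hf (ε / 2) (half_pos hε)).union (hg (ε / 2) (half_pos hε))).subset ?_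
    intro γ hγ
    by_contra h
    simp only [Set.mem_union, Set.mem_ofPred_eq, not_or, not_le] at h
    have h1 : ε ≤ ‖f γ + g γ‖ := hγ
    have h2 := norm_add_le (f γ) (g γ)
    linarith [h.1, h.2]
  smul_mem' := by
    intro c f hf ε hε
    have hc : 0 < ‖c‖ + 1 := by positivity
    refine (hf (ε / (‖c‖ + 1)) (div_pos hε hc)).subset ?_
    intro γ hγ
    have h1 : ε ≤ ‖c * f γ‖ := hγ
    rw [norm_mul] at h1
    have h2 : ε / (‖c‖ + 1) ≤ ‖f γ‖ := by
      rw [div_le_iff₀ hc]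
      nlinarith [norm_nonneg (f γ)]
    exact h2

/-- The Banach algebra `ℬ(X)` of bounded operators on `X`, with the operator norm. -/
abbrev BoundedOps (𝕜 : Type*) [RCLike 𝕜] (X : Type*) [NormedAddCommGroup X] [NormedSpace 𝕜 X] :=
  X →L[𝕜] X

section Factorization

variable (𝕜 : Type*) [RCLike 𝕜]
  (X : Type*) [NormedAddCommGroup X] [NormedSpace 𝕜 X]
  (Y : Type*) [NormedAddCommGroup Y] [NormedSpace 𝕜 Y]
  (Z : Type*) [NormedAddCommGroup Z] [NormedSpace 𝕜 Z]

/-- `𝒢_Z(X, Y)`: the linear span of the operators `X → Y` that factor through `Z`. -/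
def factorOps : Submodule 𝕜 (X →L[𝕜] Y) :=
  Submodule.span 𝕜 {R | ∃ (S : X →L[𝕜] Z) (T : Z →L[𝕜] Y), R = T.comp S}

/-- The closure of `𝒢_Z(X, Y)` in the operator norm. -/
def closedFactorOps : Submodule 𝕜 (X →L[𝕜] Y) :=
  (factorOps 𝕜 X Y Z).topologicalClosure

variable {𝕜 X Z}

theorem factorOps_mul_left (A : X →L[𝕜] X) {R : X →L[𝕜] X} (hR : R ∈ factorOps 𝕜 X X Z) :
    A * R ∈ factorOps 𝕜 X X Z := by
  induction hR using Submodule.span_induction with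
  | mem R h =>
    obtain ⟨S, T, rfl⟩ := h
    exact Submodule.subset_span ⟨S, A.comp T, rfl⟩
  | zero => rw [mul_zero]; exact zero_mem _
  | add R R' _ _ h h' => rw [mul_add]; exact add_mem h h'
  | smul c R _ h => rw [mul_smul_comm]; exact Submodule.smul_mem _ c h

theorem factorOps_mul_right (A : X →L[𝕜] X) {R : X →L[𝕜] X} (hR : R ∈ factorOps 𝕜 X X Z) :
    R * A ∈ factorOps 𝕜 X X Z := by
  induction hR using Submodule.span_induction with
  | mem R h =>
    obtain ⟨S, T, rfl⟩ := h
    exact Submodule.subset_span ⟨S.comp A, T, rfl⟩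
  | zero => rw [zero_mul]; exact zero_mem _
  | add R R' _ _ h h' => rw [add_mul]; exact add_mem h h'
  | smul c R _ h => rw [smul_mul_assoc]; exact Submodule.smul_mem _ c h

theorem closedFactorOps_mul_left (A : X →L[𝕜] X) {R : X →L[𝕜] X}
    (hR : R ∈ closedFactorOps 𝕜 X X Z) : A * R ∈ closedFactorOps 𝕜 X X Z :=
  map_mem_closure (f := fun R => A * R) (continuous_const_mul A) hR
    fun _ h => factorOps_mul_left A h

theorem closedFactorOps_mul_right (A : X →L[𝕜] X) {R : X →L[𝕜] X}
    (hR : R ∈ closedFactorOps 𝕜 X X Z) : R * A ∈ closedFactorOps 𝕜 X X Z :=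
  map_mem_closure (f := fun R => R * A) (continuous_mul_const A) hR
    fun _ h => factorOps_mul_right A h

variable (𝕜 X Z)

/-- The closure of `𝒢_Z(X) = 𝒢_Z(X, X)`, as a two-sided ideal of the algebra `ℬ(X)` of bounded
operators on `X`. -/
def closedFactorIdeal : TwoSidedIdeal (BoundedOps 𝕜 X) :=
  TwoSidedIdeal.mk' (closedFactorOps 𝕜 X X Z : Set (X →L[𝕜] X))
    (zero_mem _) (fun h h' => add_mem h h') (fun h => neg_mem h)
    (closedFactorOps_mul_left _) (closedFactorOps_mul_right _)

end Factorization

/-! It suffices to show that the identity of `c₀(ω₁)` factors as `U T V` through every `T` that lies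
in the larger ideal but not in the smaller one. Any ideal containing `T` then contains each `B A =
(B U) T (V A)`, and a closed one contains the whole larger ideal
(`closedFactorIdeal_le_of_factor_id`).

Let `P` be multiplication by the indicator of `[0, a]` with `a < ω₁`. Both `P T` and `T P` involve
only countably many coordinates of `c₀(ω₁)`, so they lie in the ideal of `c₀` (`headProj_mul_mem`,
`mul_headProj_mem`). Hence, if `T` has positive distance from that ideal, then for every `a < ω₁`
some `f` vanishing on `[0, a]` and at `ω₁` has an image `T f` that is large somewhere beyond `a`
(`exists_norm_sub_le`).

Continuous functions are eventually constant, and bounded functionals vanish on functions supported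
far out. So each such `f` can be chosen independent of any countable collection of earlier ones
(`exists_bump_indep`), and Zorn's lemma gives a family indexed by `ω₁`. `V` sends the unit vectors
to these functions, and `U` reads off differences of point values at marked points. These
differences tend to zero because the marked pairs lie in disjoint intervals (`finite_le_norm_sub`).
-/

/-! ### The ordinal interval `[0, ω₁]` -/

/-- The largest point `ω₁` of the interval `[0, ω₁]`. -/
noncomputable def topPt : OrdIccOmegaOne := ⟨ω₁, zero_le, le_rfl⟩

theorem le_topPt (x : OrdIccOmegaOne) : x ≤ topPt := x.2.2

theorem isOpen_Iic_of_lt_topPt {a : OrdIccOmegaOne} (ha : a < topPt) : IsOpen (Set.Iic a) := by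
  have h : Set.Iic a = {x : OrdIccOmegaOne | x < ⟨Order.succ a.1, zero_le, Order.succ_le_of_lt ha⟩} := by
    ext x
    exact (Order.lt_succ_iff (a := x.1) (b := a.1)).symm
  rw [h]
  exact isOpen_Iio

theorem isClopen_Iic_of_lt_topPt {a : OrdIccOmegaOne} (ha : a < topPt) : IsClopen (Set.Iic a) :=
  ⟨isClosed_Iic, isOpen_Iic_of_lt_topPt ha⟩

theorem countable_Iic_of_lt_topPt {a : OrdIccOmegaOne} (ha : a < topPt) :
    (Set.Iic a).Countable := by
  have h : (Set.Iic a.1).Countable := by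
    have h1 : a.1 < ω₁ := ha
    rw [← Order.Iio_succ, ← Cardinal.le_aleph0_iff_set_countable, Cardinal.mk_Iio_ordinal,
      Cardinal.lift_le_aleph0]
    have h2 : Order.succ a.1 < ω₁ := (Cardinal.isSuccLimit_omega 1).succ_lt h1
    generalize Order.succ a.1 = o at h2
    rw [← Cardinal.ord_aleph, Cardinal.lt_ord, ← Cardinal.succ_aleph0] at h2
    exact Order.lt_succ_iff.mp h2
  exact h.preimage Subtype.val_injective

/-- `ω₁` has uncountable cofinality. Every later argument that merges countably many thresholds into
one rests on this. -/
theorem exists_lt_topPt_forall_le {s : Set OrdIccOmegaOne} (hs : s.Countable)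
    (h : ∀ x ∈ s, x < topPt) : ∃ b < topPt, ∀ x ∈ s, x ≤ b := by
  have : Countable s := hs.to_subtype
  have hb : BddAbove (Set.range fun x : s => x.1.1) := ⟨ω₁, by rintro _ ⟨x, rfl⟩; exact x.1.2.2⟩
  have h1 : ⨆ x : s, x.1.1 < ω₁ := Ordinal.iSup_lt_omega_one fun x => h x.1 x.2
  exact ⟨⟨_, zero_le, h1.le⟩, h1, fun x hx => le_ciSup hb ⟨x, hx⟩⟩

theorem exists_succ_lt_topPt {a : OrdIccOmegaOne} (ha : a < topPt) : ∃ b, a < b ∧ b < topPt :=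
  ⟨⟨Order.succ a.1, zero_le, Order.succ_le_of_lt ha⟩, Order.lt_succ a.1,
    (Cardinal.isSuccLimit_omega 1).succ_lt ha⟩

theorem exists_lt_topPt : ∃ a : OrdIccOmegaOne, a < topPt :=
  ⟨⟨0, le_rfl, zero_le⟩, Ordinal.omega_pos 1⟩

theorem exists_injective_of_not_countable.{u} {D : Type u} {S : Set D} (hS : ¬ S.Countable) :
    ∃ i : CountableOrd → D, Function.Injective i ∧ ∀ γ, i γ ∈ S := by
  have h : Cardinal.lift.{u} (Cardinal.mk CountableOrd) ≤ Cardinal.lift.{1} (Cardinal.mk S) := by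
    rw [Cardinal.mk_Iio_ordinal, Ordinal.card_omega]
    rw [← Cardinal.le_aleph0_iff_set_countable, not_le, ← Order.succ_le_iff,
      Cardinal.succ_aleph0] at hS
    simpa using hS
  obtain ⟨i⟩ := Cardinal.lift_mk_le'.mp h
  exact ⟨fun γ => i γ, Subtype.val_injective.comp i.injective, fun γ => (i γ).2⟩

/-- If every countable set admits a point related to all of its members but outside of it, then
there is a pairwise related family indexed by the countable ordinals. -/
theorem exists_pairwise_family {D : Type*} {r : D → D → Prop} (hr : ∀ s t, r s t → r t s)
    (h : ∀ S : Set D, S.Countable → ∃ t, t ∉ S ∧ ∀ s ∈ S, r t s) :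
    ∃ i : CountableOrd → D, ∀ γ η, γ ≠ η → r (i γ) (i η) := by
  obtain ⟨S, hS⟩ := zorn_subset {S : Set D | S.Pairwise r} (by
    intro c hc hcc
    exact ⟨⋃₀ c, (Set.pairwise_sUnion hcc.directedOn).2 fun s hs => hc hs,
      fun s hs => Set.subset_sUnion_of_mem hs⟩)
  -- Zorn's lemma replaces transfinite recursion: a countable maximal set could be enlarged, so the
  -- maximal set has at least `ℵ₁` elements.
  have hunc : ¬ S.Countable := by
    intro hc
    obtain ⟨t, ht, hts⟩ := h S hc
    have h1 : (insert t S).Pairwise r :=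
      Set.Pairwise.insert hS.prop fun s hs _ => ⟨hts s hs, hr _ _ (hts s hs)⟩
    exact ht (hS.le_of_ge h1 (Set.subset_insert t S) (Set.mem_insert t S))
  obtain ⟨i, hi, hiS⟩ := exists_injective_of_not_countable hunc
  exact ⟨i, fun γ η hne => hS.prop (hiS γ) (hiS η) (hi.ne hne)⟩

/-! ### The Banach space `c₀(Γ)` -/

/-- A bounded operator commutes with finite sums. -/
theorem clm_map_sum {𝕜 E F ι : Type*} [RCLike 𝕜] [NormedAddCommGroup E] [NormedSpace 𝕜 E]
    [NormedAddCommGroup F] [NormedSpace 𝕜 F] (φ : E →L[𝕜] F) (f : ι → E) (t : Finset ι) :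
    φ (∑ i ∈ t, f i) = ∑ i ∈ t, φ (f i) :=
  map_sum φ f t

section CZero

variable {𝕜 : Type*} [RCLike 𝕜] {Γ : Type*}

namespace cZero

theorem finite_le_norm (c : cZero 𝕜 Γ) {ε : ℝ} (hε : 0 < ε) : {γ | ε ≤ ‖c.1 γ‖}.Finite :=
  c.2 ε hε

theorem norm_apply_le (c : cZero 𝕜 Γ) (γ : Γ) : ‖c.1 γ‖ ≤ ‖c‖ :=
  lp.norm_apply_le_norm ENNReal.top_ne_zero c.1 γ

theorem norm_le_of_forall_le (c : cZero 𝕜 Γ) {C : ℝ} (hC : 0 ≤ C) (h : ∀ γ, ‖c.1 γ‖ ≤ C) :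
    ‖c‖ ≤ C :=
  lp.norm_le_of_forall_le hC h

/-- The coordinate functional at `γ`. -/
noncomputable def coord (𝕜 : Type*) [RCLike 𝕜] {Γ : Type*} (γ : Γ) : cZero 𝕜 Γ →L[𝕜] 𝕜 :=
  LinearMap.mkContinuous
    { toFun := fun c => c.1 γ
      map_add' := fun _ _ => rfl
      map_smul' := fun _ _ => rfl } 1 fun c => by
      rw [one_mul]; exact norm_apply_le c γ

@[simp] theorem coord_apply (γ : Γ) (c : cZero 𝕜 Γ) : coord 𝕜 γ c = c.1 γ := rfl

theorem memℓp_of_finite {f : Γ → 𝕜} (h : ∀ ε : ℝ, 0 < ε → {γ | ε ≤ ‖f γ‖}.Finite) :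
    Memℓp f ∞ := by
  refine memℓp_infty ?_
  obtain ⟨M, hM⟩ := ((h 1 one_pos).image fun γ => ‖f γ‖).bddAbove
  refine ⟨max M 1, ?_⟩
  rintro _ ⟨γ, rfl⟩
  rcases le_total 1 ‖f γ‖ with h1 | h1
  · exact (hM ⟨γ, h1, rfl⟩).trans (le_max_left _ _)
  · exact h1.trans (le_max_right _ _)

/-- A uniformly bounded family of functionals all of whose evaluations vanish at infinity defines
an operator into `c₀(Γ)`. -/
noncomputable def lift {E : Type*} [NormedAddCommGroup E] [NormedSpace 𝕜 E] (φ : Γ → E →L[𝕜] 𝕜)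
    {C : ℝ} (hC : 0 ≤ C) (hφ : ∀ γ x, ‖φ γ x‖ ≤ C * ‖x‖)
    (h : ∀ x, ∀ ε : ℝ, 0 < ε → {γ | ε ≤ ‖φ γ x‖}.Finite) : E →L[𝕜] cZero 𝕜 Γ :=
  LinearMap.mkContinuous
    { toFun := fun x => ⟨⟨fun γ => φ γ x, memℓp_of_finite (h x)⟩, h x⟩
      map_add' := fun x y => Subtype.ext (Subtype.ext (funext fun γ => map_add (φ γ) x y))
      map_smul' := fun c x => Subtype.ext (Subtype.ext (funext fun γ => map_smul (φ γ) c x)) } C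
    fun x => norm_le_of_forall_le _ (by positivity) fun γ => hφ γ x

@[simp] theorem lift_apply {E : Type*} [NormedAddCommGroup E] [NormedSpace 𝕜 E]
    (φ : Γ → E →L[𝕜] 𝕜) {C : ℝ} (hC : 0 ≤ C) (hφ : ∀ γ x, ‖φ γ x‖ ≤ C * ‖x‖)
    (h : ∀ x, ∀ ε : ℝ, 0 < ε → {γ | ε ≤ ‖φ γ x‖}.Finite) (x : E) (γ : Γ) :
    (lift φ hC hφ h x).1 γ = φ γ x := rfl

theorem ext_apply {c d : cZero 𝕜 Γ} (h : ∀ γ, c.1 γ = d.1 γ) : c = d :=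
  Subtype.ext (Subtype.ext (funext h))

/-- Restriction of `c₀`-functions along an injection. -/
noncomputable def restrict (𝕜 : Type*) [RCLike 𝕜] {Γ Δ : Type*} (j : Γ → Δ)
    (hj : Function.Injective j) : cZero 𝕜 Δ →L[𝕜] cZero 𝕜 Γ :=
  lift (fun γ => coord 𝕜 (j γ)) zero_le_one
    (fun γ c => by simpa using norm_apply_le c (j γ))
    fun c ε hε => Set.Finite.preimage (f := j) hj.injOn (finite_le_norm c hε)

@[simp] theorem restrict_apply {Δ : Type*} (j : Γ → Δ) (hj : Function.Injective j)
    (c : cZero 𝕜 Δ) (γ : Γ) : (restrict 𝕜 j hj c).1 γ = c.1 (j γ) := rfl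

open Classical in
/-- Extension by zero of `c₀`-functions along an injection. -/
noncomputable def extend (𝕜 : Type*) [RCLike 𝕜] {Γ Δ : Type*} (j : Γ → Δ) :
    cZero 𝕜 Γ →L[𝕜] cZero 𝕜 Δ :=
  lift (fun δ => if h : ∃ γ, j γ = δ then coord 𝕜 h.choose else 0) zero_le_one
    (fun δ c => by
      by_cases h : ∃ γ, j γ = δ
      · simpa [h] using norm_apply_le c h.choose
      · simp [h])
    fun c ε hε => by
      refine ((finite_le_norm c hε).image j).subset fun δ hδ => ?_
      by_cases h : ∃ γ, j γ = δ
      · refine ⟨h.choose, ?_, h.choose_spec⟩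
        simpa [h] using hδ
      · simp [h] at hδ
        exact absurd hδ (not_le.mpr hε)

theorem extend_apply {Δ : Type*} (j : Γ → Δ) (hj : Function.Injective j) (c : cZero 𝕜 Γ) (γ : Γ) :
    (extend 𝕜 j c).1 (j γ) = c.1 γ := by
  have h : ∃ γ', j γ' = j γ := ⟨γ, rfl⟩
  have h1 : h.choose = γ := hj h.choose_spec
  simp [extend, h1]

theorem extend_apply_of_notMem {Δ : Type*} (j : Γ → Δ)
    (c : cZero 𝕜 Γ) {δ : Δ} (hδ : δ ∉ Set.range j) : (extend 𝕜 j c).1 δ = 0 := by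
  have h : ¬ ∃ γ, j γ = δ := hδ
  simp [extend, h]

open Classical in
/-- The unit vector at `γ`. -/
noncomputable def unit (𝕜 : Type*) [RCLike 𝕜] {Γ : Type*} (γ : Γ) : cZero 𝕜 Γ :=
  ⟨⟨Pi.single γ 1, memℓp_of_finite fun ε hε => (Set.finite_singleton γ).subset fun η hη => by
      by_contra hne
      have : (Pi.single γ (1 : 𝕜) : Γ → 𝕜) η = 0 := Pi.single_eq_of_ne hne _
      simp only [Set.mem_ofPred_eq, this, norm_zero] at hη
      exact hε.not_ge hη⟩,
    fun ε hε => (Set.finite_singleton γ).subset fun η hη => by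
      by_contra hne
      have : (Pi.single γ (1 : 𝕜) : Γ → 𝕜) η = 0 := Pi.single_eq_of_ne hne _
      have hη' : ε ≤ ‖(Pi.single γ (1 : 𝕜) : Γ → 𝕜) η‖ := hη
      rw [this, norm_zero] at hη'
      exact hε.not_ge hη'⟩

open Classical in
theorem unit_apply (γ η : Γ) : (unit 𝕜 γ).1 η = if η = γ then 1 else 0 :=
  Pi.single_apply γ 1 η

open Classical in
theorem sum_smul_unit_apply (t : Finset Γ) (c : Γ → 𝕜) (η : Γ) :
    (∑ γ ∈ t, c γ • unit 𝕜 γ : cZero 𝕜 Γ).1 η = if η ∈ t then c η else 0 := by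
  have h : (∑ γ ∈ t, c γ • unit 𝕜 γ : cZero 𝕜 Γ).1 η = ∑ γ ∈ t, c γ * (unit 𝕜 γ).1 η := by
    exact clm_map_sum (E := cZero 𝕜 Γ) (F := 𝕜) (coord 𝕜 η) (fun γ => c γ • unit 𝕜 γ) t
  rw [h]
  simp [unit_apply]

theorem hasSum_unit (c : cZero 𝕜 Γ) : HasSum (fun γ => c.1 γ • unit 𝕜 γ) c := by
  classical
  rw [HasSum, SummationFilter.unconditional_filter, Metric.tendsto_atTop]
  intro ε hε
  refine ⟨(finite_le_norm c (half_pos hε)).toFinset, fun t ht => ?_⟩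
  rw [dist_eq_norm]
  refine lt_of_le_of_lt (norm_le_of_forall_le _ (half_pos hε).le fun η => ?_) (half_lt_self hε)
  have h : (∑ γ ∈ t, c.1 γ • unit 𝕜 γ - c : cZero 𝕜 Γ).1 η
      = (∑ γ ∈ t, c.1 γ • unit 𝕜 γ : cZero 𝕜 Γ).1 η - c.1 η := rfl
  rw [h, sum_smul_unit_apply]
  by_cases hη : η ∈ t
  · simp [hη, (half_pos hε).le]
  · rw [if_neg hη, zero_sub, norm_neg]
    by_contra hlt
    exact hη (ht ((Set.Finite.mem_toFinset _).mpr (not_le.mp hlt).le))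

/-- A functional on `c₀(Γ)` depends on countably many coordinates only. -/
theorem countable_unit_ne_zero (φ : cZero 𝕜 Γ →L[𝕜] 𝕜) : {γ | φ (unit 𝕜 γ) ≠ 0}.Countable := by
  classical
  have h : Summable fun γ => ‖φ (unit 𝕜 γ)‖ := by
    refine summable_of_sum_le (c := ‖φ‖) (fun γ => norm_nonneg _) fun t => ?_
    -- Conjugate phases turn `φ` of a vector in the unit ball into the sum of the `‖φ (unit 𝕜 γ)‖`,
    -- which is therefore at most `‖φ‖`. Where `φ (unit 𝕜 γ) = 0`, division by zero gives the phase
    -- `0`.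
    let s : Γ → 𝕜 := fun γ => (starRingEnd 𝕜) (φ (unit 𝕜 γ)) / ‖φ (unit 𝕜 γ)‖
    have hs : ∀ γ, ‖s γ‖ ≤ 1 := fun γ => by
      simp only [s, norm_div, RCLike.norm_conj, RCLike.norm_ofReal, abs_norm]
      exact div_self_le_one _
    have h1 : φ (∑ γ ∈ t, s γ • unit 𝕜 γ) = ((∑ γ ∈ t, ‖φ (unit 𝕜 γ)‖ : ℝ) : 𝕜) := by
      rw [clm_map_sum φ, RCLike.ofReal_sum]
      refine Finset.sum_congr rfl fun γ _ => ?_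
      rw [φ.map_smul, smul_eq_mul]
      by_cases h0 : φ (unit 𝕜 γ) = 0
      · rw [h0, mul_zero, norm_zero, RCLike.ofReal_zero]
      · have : (‖φ (unit 𝕜 γ)‖ : 𝕜) ≠ 0 :=
          RCLike.ofReal_ne_zero.mpr (norm_ne_zero_iff.mpr h0)
        simp only [s]
        rw [div_mul_eq_mul_div, RCLike.conj_mul, sq, mul_div_assoc, div_self this, mul_one]
    have h2 : ‖(∑ γ ∈ t, s γ • unit 𝕜 γ : cZero 𝕜 Γ)‖ ≤ 1 := by
      refine norm_le_of_forall_le _ zero_le_one fun η => ?_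
      rw [sum_smul_unit_apply]
      split_ifs
      · exact hs η
      · simp
    have h3 := φ.le_of_opNorm_le_of_le le_rfl h2
    rw [h1, RCLike.norm_ofReal, mul_one] at h3
    exact (le_abs_self _).trans h3
  exact h.countable_support.mono fun γ hγ => norm_ne_zero_iff.mpr hγ

theorem apply_eq_zero (φ : cZero 𝕜 Γ →L[𝕜] 𝕜) (c : cZero 𝕜 Γ)
    (h : ∀ γ, φ (unit 𝕜 γ) ≠ 0 → c.1 γ = 0) : φ c = 0 := by
  have h1 := (hasSum_unit c).mapL φ
  have h2 : (fun γ => φ (c.1 γ • unit 𝕜 γ)) = 0 := by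
    funext γ
    rw [φ.map_smul, Pi.zero_apply]
    by_cases h0 : φ (unit 𝕜 γ) = 0
    · rw [h0, smul_zero]
    · rw [h γ h0, zero_smul]
  rw [h2] at h1
  exact h1.unique hasSum_zero

/-- Every countable set `N` yields a factorisation through `c₀(ℕ)` of the projection of `c₀(Γ)`
onto the functions supported by `N`. -/
theorem exists_factor_proj {N : Set Γ} (hN : N.Countable) :
    ∃ (R : cZero 𝕜 Γ →L[𝕜] cZero 𝕜 ℕ) (E : cZero 𝕜 ℕ →L[𝕜] cZero 𝕜 Γ),
      ∀ c, (∀ γ ∈ N, (E (R c)).1 γ = c.1 γ) ∧ ∀ γ ∉ N, (E (R c)).1 γ = 0 := by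
  -- An injection into `ℕ` is enough, so finite `N` needs no separate case.
  obtain ⟨j, hj⟩ : ∃ j : N → ℕ, Function.Injective j := countable_iff_exists_injective N |>.mp
    hN.to_subtype
  have hi : Function.Injective ((↑) : N → Γ) := Subtype.val_injective
  refine ⟨(extend 𝕜 j).comp (restrict 𝕜 _ hi), (extend 𝕜 ((↑) : N → Γ)).comp (restrict 𝕜 j hj),
    fun c => ⟨fun γ hγ => ?_, fun γ hγ => ?_⟩⟩
  · have := extend_apply ((↑) : N → Γ) hi
      (restrict 𝕜 j hj (extend 𝕜 j (restrict 𝕜 _ hi c))) ⟨γ, hγ⟩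
    simpa [extend_apply _ hj] using this
  · exact extend_apply_of_notMem _ _ (by simpa using hγ)

end cZero

end CZero

/-! ### Continuous functions on `[0, ω₁]` -/

section COmegaOne

variable {𝕜 : Type*} [RCLike 𝕜]

theorem exists_Ioc_subset_of_isOpen {U : Set OrdIccOmegaOne} (hU : IsOpen U)
    (h : topPt ∈ U) : ∃ b < topPt, ∀ x, b < x → x ∈ U := by
  obtain ⟨a, ha⟩ := exists_lt_topPt
  obtain ⟨b, hb, hbU⟩ := exists_Ioc_subset_of_mem_nhds (hU.mem_nhds h) ⟨a, ha⟩
  exact ⟨b, hb, fun x hx => hbU ⟨hx, le_topPt x⟩⟩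

/-- For each `n`, `g` is within `1 / (n + 1)` of its value at `ω₁` beyond some threshold below `ω₁`.
Beyond a common bound of these countably many thresholds the two values agree. -/
theorem exists_forall_eq_topPt (g : COmegaOne 𝕜) :
    ∃ b < topPt, ∀ x, b ≤ x → g x = g topPt := by
  have h : ∀ n : ℕ, ∃ b < topPt, ∀ x, b < x → dist (g x) (g topPt) < 1 / ((n : ℝ) + 1) := fun n =>
    exists_Ioc_subset_of_isOpen
      (isOpen_lt (g.continuous.dist continuous_const) continuous_const)
      (by show dist _ _ < _; rw [dist_self]; positivity)
  choose b hb hbx using h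
  obtain ⟨c, hc, hbc⟩ := exists_lt_topPt_forall_le (Set.countable_range b)
    (by rintro _ ⟨n, rfl⟩; exact hb n)
  obtain ⟨d, hcd, hd⟩ := exists_succ_lt_topPt hc
  refine ⟨d, hd, fun x hx => ?_⟩
  by_contra hne
  obtain ⟨n, hn⟩ := exists_nat_one_div_lt (dist_pos.mpr hne)
  exact lt_asymm hn (hbx n x ((hbc _ ⟨n, rfl⟩).trans_lt (hcd.trans_le hx)))

theorem norm_sum_le_of_disjoint {ι : Type*} (f : ι → COmegaOne 𝕜) {C : ℝ} (hC : 0 ≤ C)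
    (hf : ∀ i, ‖f i‖ ≤ C) (hd : ∀ i j, i ≠ j → ∀ x, f i x = 0 ∨ f j x = 0) (t : Finset ι) :
    ‖∑ i ∈ t, f i‖ ≤ C := by
  rw [ContinuousMap.norm_le _ hC]
  intro x
  rw [ContinuousMap.sum_apply]
  by_cases h : ∃ i ∈ t, f i x ≠ 0
  · obtain ⟨i, hi, hix⟩ := h
    rw [Finset.sum_eq_single_of_mem i hi fun j _ hj => (hd j i hj x).resolve_right hix]
    exact ((f i).norm_coe_le_norm x).trans (hf i)
  · push Not at h
    rw [Finset.sum_eq_zero h, norm_zero]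
    exact hC

/-- A bounded functional is small on functions supported far to the right. -/
theorem exists_forall_norm_le (φ : COmegaOne 𝕜 →L[𝕜] 𝕜) {ε : ℝ} (hε : 0 < ε) :
    ∃ b < topPt, ∀ f : COmegaOne 𝕜, (∀ x ≤ b, f x = 0) → f topPt = 0 → ‖φ f‖ ≤ ε * ‖f‖ := by
  by_contra! H
  -- Failure of the bound yields disjointly supported functions of norm at most `ε⁻¹` on which `φ`
  -- equals `1`. The sum of `n` of them still has norm at most `ε⁻¹`, while `φ` takes the value `n`
  -- there. The second component marks a point beyond which the function vanishes, so the next one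
  -- can be placed to its right.
  let P : COmegaOne 𝕜 × OrdIccOmegaOne → Prop := fun p =>
    p.2 < topPt ∧ (∀ x, p.2 < x → p.1 x = 0) ∧ φ p.1 = 1 ∧ ‖p.1‖ ≤ ε⁻¹
  obtain ⟨F, hF, hr⟩ := exists_seq_of_forall_finset_exists P
    (fun p q => ∀ x, p.1 x = 0 ∨ q.1 x = 0) (by
      intro s hs
      obtain ⟨b, hb, hbs⟩ := exists_lt_topPt_forall_le (s.finite_toSet.image Prod.snd).countable
        (by rintro _ ⟨p, hp, rfl⟩; exact (hs p hp).1)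
      obtain ⟨f, hf0, hftop, hf⟩ := H b hb
      obtain ⟨d, hd, hdf⟩ := exists_forall_eq_topPt f
      have hφ : φ f ≠ 0 := by
        intro h0
        rw [h0, norm_zero] at hf
        exact hf.not_ge (by positivity)
      refine ⟨((φ f)⁻¹ • f, d), ⟨hd, fun x hx => ?_, ?_, ?_⟩, fun p hp x => ?_⟩
      · simp [hdf x hx.le, hftop]
      · simp [hφ]
      · rw [norm_smul, norm_inv, inv_mul_le_iff₀ (norm_pos_iff.mpr hφ), ← div_eq_mul_inv,
          le_div_iff₀ hε, mul_comm]
        exact hf.le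
      · rcases le_or_gt x b with hx | hx
        · right
          simp [hf0 x hx]
        · left
          exact (hs p hp).2.1 x ((hbs _ ⟨p, hp, rfl⟩).trans_lt hx))
  obtain ⟨n, hn⟩ := exists_nat_gt (‖φ‖ * ε⁻¹)
  have h1 : ‖∑ i ∈ Finset.range n, (F i).1‖ ≤ ε⁻¹ :=
    norm_sum_le_of_disjoint (fun i => (F i).1) (by positivity) (fun i => (hF i).2.2.2)
      (fun i j hij x => by
        rcases lt_or_gt_of_ne hij with h | h
        · exact hr i j h x
        · exact (hr j i h x).symm) _
  have h2 := φ.le_of_opNorm_le_of_le le_rfl h1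
  rw [map_sum, Finset.sum_congr rfl fun i _ => (hF i).2.2.1] at h2
  simp only [Finset.sum_const, Finset.card_range, nsmul_eq_mul, mul_one, RCLike.norm_natCast] at h2
  exact hn.not_ge h2

/-- A bounded functional vanishes on the functions supported far to the right. -/
theorem exists_forall_apply_eq_zero (φ : COmegaOne 𝕜 →L[𝕜] 𝕜) :
    ∃ b < topPt, ∀ f : COmegaOne 𝕜, (∀ x ≤ b, f x = 0) → f topPt = 0 → φ f = 0 := by
  choose b hb hbf using fun n : ℕ => exists_forall_norm_le φ (Nat.one_div_pos_of_nat (α := ℝ) (n := n))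
  obtain ⟨c, hc, hbc⟩ := exists_lt_topPt_forall_le (Set.countable_range b)
    (by rintro _ ⟨n, rfl⟩; exact hb n)
  refine ⟨c, hc, fun f hf hft => ?_⟩
  have h : ∀ n : ℕ, ‖φ f‖ ≤ 1 / ((n : ℝ) + 1) * ‖f‖ := fun n =>
    hbf n f (fun x hx => hf x (hx.trans (hbc _ ⟨n, rfl⟩))) hft
  have h1 : Filter.Tendsto (fun n : ℕ => 1 / ((n : ℝ) + 1) * ‖f‖) Filter.atTop (nhds (0 * ‖f‖)) :=
    tendsto_one_div_add_atTop_nhds_zero_nat.mul_const _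
  rw [zero_mul] at h1
  exact norm_le_zero_iff.mp (ge_of_tendsto' h1 h)

/-! ### Truncation to countable initial segments -/

/-- The indicator function of `[0, a]`. -/
noncomputable def headInd (𝕜 : Type*) [RCLike 𝕜] {a : OrdIccOmegaOne} (ha : a < topPt) :
    COmegaOne 𝕜 :=
  ⟨(Set.Iic a).indicator 1, continuous_one.indicator (fun x hx => by
    rw [(isClopen_Iic_of_lt_topPt ha).frontier_eq] at hx; exact hx.elim)⟩

/-- The projection `f ↦ f · 1_{[0, a]}`. -/
noncomputable def headProj (𝕜 : Type*) [RCLike 𝕜] {a : OrdIccOmegaOne} (ha : a < topPt) :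
    COmegaOne 𝕜 →L[𝕜] COmegaOne 𝕜 :=
  ContinuousLinearMap.mul 𝕜 (COmegaOne 𝕜) (headInd 𝕜 ha)

theorem headProj_apply_of_le {a : OrdIccOmegaOne} (ha : a < topPt) (f : COmegaOne 𝕜)
    {x : OrdIccOmegaOne} (hx : x ≤ a) : headProj 𝕜 ha f x = f x := by
  simp [headProj, headInd, hx]

theorem headProj_apply_of_lt {a : OrdIccOmegaOne} (ha : a < topPt) (f : COmegaOne 𝕜)
    {x : OrdIccOmegaOne} (hx : a < x) : headProj 𝕜 ha f x = 0 := by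
  simp [headProj, headInd, hx]

/-- The operator `A ∘ headProj` into `c₀(Γ)` has range supported by a countable set. -/
theorem countable_support_comp_headProj {Γ : Type*} (A : COmegaOne 𝕜 →L[𝕜] cZero 𝕜 Γ)
    {a : OrdIccOmegaOne} (ha : a < topPt) :
    ∃ N : Set Γ, N.Countable ∧ ∀ f, ∀ γ ∉ N, (A (headProj 𝕜 ha f)).1 γ = 0 := by
  have : Countable (Set.Iic a) := (countable_Iic_of_lt_topPt ha).to_subtype
  have : CompactSpace (Set.Iic a) := isCompact_iff_compactSpace.mp isClosed_Iic.isCompact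
  -- The retraction extends functions from `[0, a]` to `[0, ω₁]`, so `A ∘ headProj` is determined on
  -- `C([0, a])`. That space is separable because `[0, a]` is compact and countable: the supports of
  -- the images of a dense sequence cover all supports.
  let r : C(OrdIccOmegaOne, Set.Iic a) :=
    ⟨fun x => ⟨min x a, min_le_right x a⟩, by fun_prop⟩
  let h : C(Set.Iic a, 𝕜) → cZero 𝕜 Γ := fun g => A (headProj 𝕜 ha (g.comp r))
  have hh : Continuous h :=
    A.continuous.comp ((headProj 𝕜 ha).continuous.comp (ContinuousMap.continuous_precomp r))
  let D := TopologicalSpace.denseSeq C(Set.Iic a, 𝕜)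
  refine ⟨⋃ n, {γ | (h (D n)).1 γ ≠ 0}, Set.countable_iUnion fun n => ?_, fun f γ hγ => ?_⟩
  · have h1 : {γ | (h (D n)).1 γ ≠ 0} ⊆ ⋃ k : ℕ, {γ | 1 / ((k : ℝ) + 1) ≤ ‖(h (D n)).1 γ‖} := by
      intro γ hγ
      obtain ⟨k, hk⟩ := exists_nat_one_div_lt (norm_pos_iff.mpr hγ)
      exact Set.mem_iUnion.mpr ⟨k, hk.le⟩
    exact (Set.countable_iUnion fun k =>
      (cZero.finite_le_norm _ Nat.one_div_pos_of_nat).countable).mono h1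
  · have h1 : Set.range D ⊆ {g | cZero.coord 𝕜 γ (h g) = 0} := by
      rintro _ ⟨n, rfl⟩
      by_contra hne
      exact hγ (Set.mem_iUnion.mpr ⟨n, hne⟩)
    have h2 : IsClosed {g | cZero.coord 𝕜 γ (h g) = 0} :=
      isClosed_eq ((cZero.coord 𝕜 γ).continuous.comp hh) continuous_const
    have h3 := h2.closure_subset_iff.mpr h1
      ((TopologicalSpace.denseRange_denseSeq C(Set.Iic a, 𝕜)) (f.comp ⟨Subtype.val, by fun_prop⟩))
    have h4 : headProj 𝕜 ha ((f.comp ⟨Subtype.val, by fun_prop⟩ : C(Set.Iic a, 𝕜)).comp r)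
        = headProj 𝕜 ha f := by
      ext x
      rcases le_or_gt x a with hx | hx
      · rw [headProj_apply_of_le ha _ hx, headProj_apply_of_le ha _ hx]
        simp [r, min_eq_left hx]
      · rw [headProj_apply_of_lt ha _ hx, headProj_apply_of_lt ha _ hx]
    rw [← h4]
    exact h3

/-- The operator `headProj ∘ B` on `c₀(Γ)` depends on countably many coordinates only. -/
theorem countable_support_headProj_comp {Γ : Type*} (B : cZero 𝕜 Γ →L[𝕜] COmegaOne 𝕜)
    {a : OrdIccOmegaOne} (ha : a < topPt) :
    ∃ N : Set Γ, N.Countable ∧ ∀ c, (∀ γ ∈ N, c.1 γ = 0) → headProj 𝕜 ha (B c) = 0 := by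
  let φ : OrdIccOmegaOne → cZero 𝕜 Γ →L[𝕜] 𝕜 := fun x => (ContinuousMap.evalCLM 𝕜 x).comp B
  -- Only the countably many evaluations at points of `[0, a]` matter, and each depends on countably
  -- many coordinates.
  refine ⟨⋃ x ∈ Set.Iic a, {γ | φ x (cZero.unit 𝕜 γ) ≠ 0},
    (countable_Iic_of_lt_topPt ha).biUnion fun x _ => cZero.countable_unit_ne_zero (φ x),
    fun c hc => ?_⟩
  ext x
  rcases le_or_gt x a with hx | hx
  · rw [headProj_apply_of_le ha _ hx]
    exact cZero.apply_eq_zero (φ x) c fun γ hγ => hc γ (Set.mem_biUnion hx hγ)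
  · rw [headProj_apply_of_lt ha _ hx, ContinuousMap.zero_apply]

/-- Oscillation over disjoint intervals tends to zero. -/
theorem finite_le_norm_sub {ι : Type*} {a b x y : ι → OrdIccOmegaOne}
    (hx : ∀ i, x i ∈ Set.Ioc (a i) (b i)) (hy : ∀ i, y i ∈ Set.Ioc (a i) (b i))
    (hd : ∀ i j, i ≠ j → b i ≤ a j ∨ b j ≤ a i) (g : COmegaOne 𝕜) {ε : ℝ} (hε : 0 < ε) :
    {i | ε ≤ ‖g (x i) - g (y i)‖}.Finite := by
  by_contra hinf
  set I := {i | ε ≤ ‖g (x i) - g (y i)‖} with hI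
  have hab : ∀ i, a i < b i := fun i => (hx i).1.trans_le (hx i).2
  have hbinj : ∀ i j, b i = b j → i = j := fun i j h => by
    by_contra hne
    rcases hd i j hne with h1 | h1
    · exact (h1.trans_lt (hab j)).ne h
    · exact (h1.trans_lt (hab i)).ne h.symm
  -- Take the least `p` with infinitely many bad intervals ending by `p`. Near `p`, on some `(q,
  -- p]`, `g` stays within `ε / 2` of `g p`, yet infinitely many bad intervals end in `(q, p]`. Of
  -- two such disjoint intervals the right-hand one lies entirely in `(q, p]`, which is a
  -- contradiction.
  let Q : Set OrdIccOmegaOne := {p | {i ∈ I | b i ≤ p}.Infinite}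
  have hQ : Q.Nonempty := ⟨topPt, by
    have : {i ∈ I | b i ≤ topPt} = I := by ext i; simp [le_topPt]
    show {i ∈ I | b i ≤ topPt}.Infinite
    rw [this]; exact hinf⟩
  obtain ⟨p, hp, hmin⟩ := WellFounded.has_min wellFounded_lt Q hQ
  have hlt : ∃ l, l < p := by
    obtain ⟨i, hi⟩ := hp.nonempty
    exact ⟨a i, (hab i).trans_le hi.2⟩
  have hU : {z | dist (g z) (g p) < ε / 2} ∈ nhds p :=
    (isOpen_lt (g.continuous.dist continuous_const) continuous_const).mem_nhds
      (by simpa using half_pos hε)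
  obtain ⟨q, hqp, hq⟩ := exists_Ioc_subset_of_mem_nhds hU hlt
  have hqfin : {i ∈ I | b i ≤ q}.Finite := Set.not_infinite.mp fun h => hmin q h hqp
  have hinf2 := Set.Infinite.sdiff hp hqfin
  obtain ⟨i, hi, j, hj, hij⟩ := hinf2.nontrivial
  have key : ∀ i j, i ∈ {i ∈ I | b i ≤ p} \ {i ∈ I | b i ≤ q} →
      j ∈ {i ∈ I | b i ≤ p} \ {i ∈ I | b i ≤ q} → b i ≤ a j → False := by
    intro i j hi hj hbij
    have hqi : q < b i := by
      by_contra h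
      exact hi.2 ⟨hi.1.1, not_lt.mp h⟩
    have h1 : dist (g (x j)) (g p) < ε / 2 :=
      hq ⟨(hqi.trans_le hbij).trans (hx j).1, (hx j).2.trans hj.1.2⟩
    have h2 : dist (g (y j)) (g p) < ε / 2 :=
      hq ⟨(hqi.trans_le hbij).trans (hy j).1, (hy j).2.trans hj.1.2⟩
    have h3 : ε ≤ dist (g (x j)) (g (y j)) := by rw [dist_eq_norm]; exact hj.1.1
    have h4 := dist_triangle_right (g (x j)) (g (y j)) (g p)
    linarith
  rcases hd i j hij with h | h
  · exact key i j hi hj h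
  · exact key j i hj hi h

end COmegaOne

/-! ### Operators on `C([0, ω₁])` -/

section Operators

variable {𝕜 : Type*} [RCLike 𝕜]

/-- A bounded disjointly supported family in `C([0, ω₁])` spans a bounded image of `c₀(Γ)`. -/
theorem exists_hasSum_of_disjoint {Γ : Type*} (f : Γ → COmegaOne 𝕜) {C : ℝ} (hC : 0 ≤ C)
    (hf : ∀ γ, ‖f γ‖ ≤ C) (hd : ∀ γ η, γ ≠ η → ∀ x, f γ x = 0 ∨ f η x = 0) :
    ∃ V : cZero 𝕜 Γ →L[𝕜] COmegaOne 𝕜, ∀ c, HasSum (fun γ => c.1 γ • f γ) (V c) := by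
  classical
  have hbound : ∀ (c : cZero 𝕜 Γ) (t : Finset Γ) (M : ℝ), 0 ≤ M → (∀ γ ∈ t, ‖c.1 γ‖ ≤ M) →
      ‖∑ γ ∈ t, c.1 γ • f γ‖ ≤ C * M := by
    intro c t M hM ht
    have h := norm_sum_le_of_disjoint (fun γ => if γ ∈ t then c.1 γ • f γ else 0)
      (mul_nonneg hC hM) (fun γ => by
        dsimp only
        split_ifs with hγ
        · rw [norm_smul, mul_comm]
          exact mul_le_mul (hf γ) (ht γ hγ) (norm_nonneg _) hC
        · rw [norm_zero]; positivity) (fun γ η hne x => by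
        rcases hd γ η hne x with h | h
        · left; dsimp only; split_ifs <;> simp [h]
        · right; dsimp only; split_ifs <;> simp [h]) t
    rwa [Finset.sum_congr rfl fun γ hγ => if_pos hγ] at h
  -- Off a finite set the coefficients are smaller than any given `M > 0`, so `hbound` makes the
  -- tails small.
  have hsum : ∀ c : cZero 𝕜 Γ, Summable fun γ => c.1 γ • f γ := by
    intro c
    rw [summable_iff_vanishing_norm]
    intro ε hε
    obtain ⟨M, hM, hMε⟩ : ∃ M : ℝ, 0 < M ∧ C * M < ε := by
      refine ⟨ε / (C + 1), by positivity, ?_⟩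
      rw [mul_div_assoc', div_lt_iff₀ (by positivity)]
      nlinarith
    refine ⟨(cZero.finite_le_norm c hM).toFinset, fun t ht => ?_⟩
    refine (hbound c t M hM.le fun γ hγ => ?_).trans_lt hMε
    by_contra hlt
    exact Finset.disjoint_left.mp ht hγ ((Set.Finite.mem_toFinset _).mpr (not_le.mp hlt).le)
  refine ⟨LinearMap.mkContinuous
    { toFun := fun c => ∑' γ, c.1 γ • f γ
      map_add' := fun c d => by
        rw [← (hsum c).tsum_add (hsum d)]
        exact tsum_congr fun γ => add_smul (c.1 γ) (d.1 γ) (f γ)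
      map_smul' := fun k c => by
        rw [RingHom.id_apply, ← (hsum c).tsum_const_smul k]
        exact tsum_congr fun γ => mul_smul k (c.1 γ) (f γ) } C fun c => ?_,
    fun c => (hsum c).hasSum⟩
  exact le_of_tendsto (hsum c).hasSum.norm
    (Filter.Eventually.of_forall fun t => hbound c t _ (norm_nonneg c) fun γ _ =>
      cZero.norm_apply_le c γ)

/-- To see that a continuous linear map sends `closedFactorOps` into a closed subspace, it suffices
to consider operators that factor through `Z`. -/
theorem map_mem_of_mem_closedFactorOps {X Y Z W : Type*}
    [NormedAddCommGroup X] [NormedSpace 𝕜 X] [NormedAddCommGroup Y] [NormedSpace 𝕜 Y]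
    [NormedAddCommGroup Z] [NormedSpace 𝕜 Z] [NormedAddCommGroup W] [NormedSpace 𝕜 W]
    (L : (X →L[𝕜] Y) →L[𝕜] W) {M : Submodule 𝕜 W} (hM : IsClosed (M : Set W))
    (h : ∀ (S : X →L[𝕜] Z) (T : Z →L[𝕜] Y), L (T.comp S) ∈ M) {R : X →L[𝕜] Y}
    (hR : R ∈ closedFactorOps 𝕜 X Y Z) : L R ∈ M := by
  have h1 : factorOps 𝕜 X Y Z ≤ M.comap (L : (X →L[𝕜] Y) →ₗ[𝕜] W) := by
    refine Submodule.span_le.mpr ?_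
    rintro _ ⟨S, T, rfl⟩
    exact h S T
  exact Submodule.topologicalClosure_minimal _ h1 (hM.preimage L.continuous) hR

theorem isClosed_closedFactorOps {X Y Z : Type*}
    [NormedAddCommGroup X] [NormedSpace 𝕜 X] [NormedAddCommGroup Y] [NormedSpace 𝕜 Y]
    [NormedAddCommGroup Z] [NormedSpace 𝕜 Z] :
    IsClosed (closedFactorOps 𝕜 X Y Z : Set (X →L[𝕜] Y)) :=
  Submodule.isClosed_topologicalClosure _

theorem comp_mem_closedFactorOps {X Y Z : Type*}
    [NormedAddCommGroup X] [NormedSpace 𝕜 X] [NormedAddCommGroup Y] [NormedSpace 𝕜 Y]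
    [NormedAddCommGroup Z] [NormedSpace 𝕜 Z] (S : X →L[𝕜] Z) (T : Z →L[𝕜] Y) :
    T.comp S ∈ closedFactorOps 𝕜 X Y Z :=
  Submodule.le_topologicalClosure _ (Submodule.subset_span ⟨S, T, rfl⟩)

theorem mul_mem_closedFactorOps_right {X Z Z' : Type*}
    [NormedAddCommGroup X] [NormedSpace 𝕜 X] [NormedAddCommGroup Z] [NormedSpace 𝕜 Z]
    [NormedAddCommGroup Z'] [NormedSpace 𝕜 Z'] (P : X →L[𝕜] X)
    (h : ∀ (A : X →L[𝕜] Z) (B : Z →L[𝕜] X), (B.comp A) * P ∈ closedFactorOps 𝕜 X X Z')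
    {T : X →L[𝕜] X} (hT : T ∈ closedFactorOps 𝕜 X X Z) : T * P ∈ closedFactorOps 𝕜 X X Z' :=
  map_mem_of_mem_closedFactorOps (M := closedFactorOps 𝕜 X X Z')
    ((ContinuousLinearMap.compL 𝕜 X X X).flip P) isClosed_closedFactorOps h hT

theorem mul_mem_closedFactorOps_left {X Z Z' : Type*}
    [NormedAddCommGroup X] [NormedSpace 𝕜 X] [NormedAddCommGroup Z] [NormedSpace 𝕜 Z]
    [NormedAddCommGroup Z'] [NormedSpace 𝕜 Z'] (P : X →L[𝕜] X)
    (h : ∀ (A : X →L[𝕜] Z) (B : Z →L[𝕜] X), P * (B.comp A) ∈ closedFactorOps 𝕜 X X Z')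
    {T : X →L[𝕜] X} (hT : T ∈ closedFactorOps 𝕜 X X Z) : P * T ∈ closedFactorOps 𝕜 X X Z' :=
  map_mem_of_mem_closedFactorOps (M := closedFactorOps 𝕜 X X Z')
    (ContinuousLinearMap.compL 𝕜 X X X P) isClosed_closedFactorOps h hT

/-- The range of `A ∘ headProj` is supported by a countable set. Inserting the coordinate projection
onto that set, which factors through `c₀(ℕ)`, changes nothing. -/
theorem mul_headProj_mem {Γ : Type*} {T : COmegaOne 𝕜 →L[𝕜] COmegaOne 𝕜}
    (hT : T ∈ closedFactorOps 𝕜 (COmegaOne 𝕜) (COmegaOne 𝕜) (cZero 𝕜 Γ))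
    {a : OrdIccOmegaOne} (ha : a < topPt) :
    T * headProj 𝕜 ha ∈ closedFactorOps 𝕜 (COmegaOne 𝕜) (COmegaOne 𝕜) (cZero 𝕜 ℕ) := by
  refine mul_mem_closedFactorOps_right (headProj 𝕜 ha) (fun A B => ?_) hT
  obtain ⟨N, hN, hAN⟩ := countable_support_comp_headProj A ha
  obtain ⟨R, E, hRE⟩ := cZero.exists_factor_proj (𝕜 := 𝕜) hN
  have h : (B.comp A) * headProj 𝕜 ha = (B.comp E).comp (R.comp (A.comp (headProj 𝕜 ha))) := by
    refine ContinuousLinearMap.ext fun f => congrArg B (cZero.ext_apply fun γ => ?_)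
    by_cases hγ : γ ∈ N
    · exact ((hRE (A (headProj 𝕜 ha f))).1 γ hγ).symm
    · exact (hAN f γ hγ).trans ((hRE (A (headProj 𝕜 ha f))).2 γ hγ).symm
  rw [h]
  exact comp_mem_closedFactorOps _ _

/-- Dual argument: `headProj ∘ B` ignores all but countably many coordinates, so the projection can
be inserted in front of `B`. -/
theorem headProj_mul_mem {Γ : Type*} {T : COmegaOne 𝕜 →L[𝕜] COmegaOne 𝕜}
    (hT : T ∈ closedFactorOps 𝕜 (COmegaOne 𝕜) (COmegaOne 𝕜) (cZero 𝕜 Γ))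
    {a : OrdIccOmegaOne} (ha : a < topPt) :
    headProj 𝕜 ha * T ∈ closedFactorOps 𝕜 (COmegaOne 𝕜) (COmegaOne 𝕜) (cZero 𝕜 ℕ) := by
  refine mul_mem_closedFactorOps_left (headProj 𝕜 ha) (fun A B => ?_) hT
  obtain ⟨N, hN, hBN⟩ := countable_support_headProj_comp B ha
  obtain ⟨R, E, hRE⟩ := cZero.exists_factor_proj (𝕜 := 𝕜) hN
  have h : headProj 𝕜 ha * (B.comp A) = (((headProj 𝕜 ha).comp B).comp E).comp (R.comp A) := by
    refine ContinuousLinearMap.ext fun f => ?_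
    have h1 := hBN (A f - E (R (A f))) fun γ hγ => by
      have : (A f - E (R (A f))).1 γ = (A f).1 γ - (E (R (A f))).1 γ := rfl
      rw [this, (hRE (A f)).1 γ hγ, sub_self]
    rw [B.map_sub, map_sub] at h1
    exact sub_eq_zero.mp h1
  rw [h]
  exact comp_mem_closedFactorOps _ _

/-- Rank-one operators factor through `c₀`. -/
theorem smulRight_mem (φ : COmegaOne 𝕜 →L[𝕜] 𝕜) (g : COmegaOne 𝕜) :
    φ.smulRight g ∈ closedFactorOps 𝕜 (COmegaOne 𝕜) (COmegaOne 𝕜) (cZero 𝕜 ℕ) := by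
  have h : φ.smulRight g
      = ((cZero.coord 𝕜 (0 : ℕ)).smulRight g).comp (φ.smulRight (cZero.unit 𝕜 (0 : ℕ))) := by
    ext f x
    have : (φ f • cZero.unit 𝕜 (0 : ℕ)).1 0 = φ f * (cZero.unit 𝕜 (0 : ℕ)).1 0 := rfl
    simp only [ContinuousLinearMap.smulRight_apply, ContinuousLinearMap.comp_apply,
      cZero.coord_apply, this, cZero.unit_apply, if_true, mul_one]
  rw [h]
  exact comp_mem_closedFactorOps _ _

/-- Used with `p` a truncation and `r` of rank one: the bracket on the left lies in the ideal of
`c₀`, and the right-hand side is the remainder to be estimated. -/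
theorem sub_eq_mul_mul_sub {A : Type*} [Ring A] (t p r : A) :
    t - (p * t + (1 - p) * (t * p + t * r)) = (1 - p) * (t * (1 - p - r)) := by
  simp only [mul_sub, sub_mul, mul_add, one_mul, mul_one]
  abel

/-- If `T` is in the ideal of `c₀(Γ)` and small from `[a, ω₁]` to itself, then it is close to the
ideal of `c₀`. -/
theorem exists_norm_sub_le {Γ : Type*} {T : COmegaOne 𝕜 →L[𝕜] COmegaOne 𝕜}
    (hT : T ∈ closedFactorOps 𝕜 (COmegaOne 𝕜) (COmegaOne 𝕜) (cZero 𝕜 Γ))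
    {a : OrdIccOmegaOne} (ha : a < topPt) {δ : ℝ} (hδ : 0 ≤ δ)
    (h : ∀ f : COmegaOne 𝕜, (∀ x ≤ a, f x = 0) → f topPt = 0 →
      ∀ x, a < x → ‖T f x‖ ≤ δ * ‖f‖) :
    ∃ R ∈ closedFactorOps 𝕜 (COmegaOne 𝕜) (COmegaOne 𝕜) (cZero 𝕜 ℕ), ‖T - R‖ ≤ 2 * δ := by
  let P := headProj 𝕜 ha
  let g : COmegaOne 𝕜 := 1 - headInd 𝕜 ha
  -- Subtracting the constant `f topPt` on `(a, ω₁]` makes `(1 - P - ρ) f` vanish at `ω₁`, as `h`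
  -- requires. It costs the factor `2` in the estimate.
  let ρ : COmegaOne 𝕜 →L[𝕜] COmegaOne 𝕜 := (ContinuousMap.evalCLM 𝕜 topPt).smulRight g
  refine ⟨P * T + (1 - P) * (T * P + T * ρ), ?_, ?_⟩
  · exact add_mem (headProj_mul_mem hT ha) (closedFactorOps_mul_left _
      (add_mem (mul_headProj_mem hT ha)
        (closedFactorOps_mul_left _ (smulRight_mem _ _))))
  · have h1 : T - (P * T + (1 - P) * (T * P + T * ρ)) = (1 - P) * (T * (1 - P - ρ)) :=
      sub_eq_mul_mul_sub T P ρ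
    rw [h1]
    refine ContinuousLinearMap.opNorm_le_bound _ (by positivity) fun f => ?_
    have hPz : ∀ u : COmegaOne 𝕜, ∀ x ≤ a, (1 - P) u x = 0 := fun u x hx => by
      simp [P, headProj_apply_of_le ha u hx]
    have hPx : ∀ u : COmegaOne 𝕜, ∀ x, a < x → (1 - P) u x = u x := fun u x hx => by
      simp [P, headProj_apply_of_lt ha u hx]
    have hρ0 : ∀ x ≤ a, ρ f x = 0 := fun x hx => by
      simp [ρ, g, headInd, hx]
    have hρ1 : ∀ x, a < x → ρ f x = f topPt := fun x hx => by
      simp [ρ, g, headInd, hx]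
    have hq0 : ∀ x ≤ a, (1 - P - ρ) f x = 0 := fun x hx => by
      show (1 - P) f x - ρ f x = 0
      rw [hPz f x hx, hρ0 x hx, sub_zero]
    have hq1 : ∀ x, a < x → (1 - P - ρ) f x = f x - f topPt := fun x hx => by
      show (1 - P) f x - ρ f x = _
      rw [hPx f x hx, hρ1 x hx]
    have hqn : ‖(1 - P - ρ) f‖ ≤ 2 * ‖f‖ := by
      rw [ContinuousMap.norm_le _ (by positivity)]
      intro x
      rcases le_or_gt x a with hx | hx
      · rw [hq0 x hx, norm_zero]; positivity
      · rw [hq1 x hx]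
        have := norm_sub_le (f x) (f topPt)
        linarith [f.norm_coe_le_norm x, f.norm_coe_le_norm topPt]
    rw [ContinuousMap.norm_le _ (by positivity)]
    intro x
    show ‖(1 - P) (T ((1 - P - ρ) f)) x‖ ≤ _
    rcases le_or_gt x a with hx | hx
    · rw [hPz _ x hx, norm_zero]; positivity
    · rw [hPx _ x hx]
      refine (h _ hq0 (by rw [hq1 _ ha, sub_self]) x hx).trans ?_
      nlinarith

/-! ### Independent bumps and the factorisation of the identity of `c₀(Γ)` -/

/-- A function supported in `(a, b]` that `T` maps to a function separating two points of
`(a, b]`. -/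
structure Bump (T : COmegaOne 𝕜 →L[𝕜] COmegaOne 𝕜) (C : ℝ) where
  f : COmegaOne 𝕜
  a : OrdIccOmegaOne
  b : OrdIccOmegaOne
  x : OrdIccOmegaOne
  y : OrdIccOmegaOne
  lt_topPt : b < topPt
  hx : x ∈ Set.Ioc a b
  hy : y ∈ Set.Ioc a b
  apply_of_le : ∀ z ≤ a, f z = 0
  apply_of_lt : ∀ z, b < z → f z = 0
  norm_le : ‖f‖ ≤ C
  map_x : T f x = 1
  map_y : T f y = 0
  map_topPt : T f topPt = 0

/-- Two bumps are independent if their intervals are disjoint and the image of each of them vanishes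
at the marked points of the other. -/
def Bump.Indep {T : COmegaOne 𝕜 →L[𝕜] COmegaOne 𝕜} {C : ℝ} (s t : Bump T C) : Prop :=
  (s.b ≤ t.a ∨ t.b ≤ s.a) ∧ (T s.f t.x = 0 ∧ T s.f t.y = 0) ∧ T t.f s.x = 0 ∧ T t.f s.y = 0

theorem Bump.Indep.symm {T : COmegaOne 𝕜 →L[𝕜] COmegaOne 𝕜} {C : ℝ} {s t : Bump T C}
    (h : s.Indep t) : t.Indep s :=
  ⟨h.1.symm, h.2.2, h.2.1⟩

/-- Independence from a countable `S` amounts to countably many lower bounds on the left end `a` of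
the new interval. Beyond `β z`, functions vanishing at `ω₁` have images vanishing at `z`; beyond `e
g`, the function `g` equals its value at `ω₁`. -/
theorem exists_bump_indep {T : COmegaOne 𝕜 →L[𝕜] COmegaOne 𝕜} {δ : ℝ} (hδ : 0 < δ)
    (H : ∀ a < topPt, ∃ f : COmegaOne 𝕜, (∀ x ≤ a, f x = 0) ∧ f topPt = 0 ∧
      ∃ x, a < x ∧ δ * ‖f‖ < ‖T f x‖) {S : Set (Bump T δ⁻¹)} (hS : S.Countable) :
    ∃ t, t ∉ S ∧ ∀ s ∈ S, Bump.Indep t s := by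
  choose β hβ hβf using fun z => exists_forall_apply_eq_zero ((ContinuousMap.evalCLM 𝕜 z).comp T)
  choose e he hef using fun g : COmegaOne 𝕜 => exists_forall_eq_topPt g
  obtain ⟨a, ha, hSa⟩ := exists_lt_topPt_forall_le
    (s := {β topPt} ∪ (Bump.b '' S ∪ ((fun s => β s.x) '' S ∪ ((fun s => β s.y) '' S ∪
      (fun s => e (T s.f)) '' S))))
    ((Set.countable_singleton _).union ((hS.image _).union ((hS.image _).union
      ((hS.image _).union (hS.image _))))) (by
      rintro z (rfl | ⟨s, -, rfl⟩ | ⟨s, -, rfl⟩ | ⟨s, -, rfl⟩ | ⟨s, -, rfl⟩)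
      exacts [hβ _, s.lt_topPt, hβ _, hβ _, he _])
  have hab : ∀ s ∈ S, s.b ≤ a := fun s hs => hSa _ (Or.inr (Or.inl ⟨s, hs, rfl⟩))
  have hax : ∀ s ∈ S, β s.x ≤ a := fun s hs => hSa _ (Or.inr (Or.inr (Or.inl ⟨s, hs, rfl⟩)))
  have hay : ∀ s ∈ S, β s.y ≤ a := fun s hs =>
    hSa _ (Or.inr (Or.inr (Or.inr (Or.inl ⟨s, hs, rfl⟩))))
  have hae : ∀ s ∈ S, e (T s.f) ≤ a := fun s hs =>
    hSa _ (Or.inr (Or.inr (Or.inr (Or.inr ⟨s, hs, rfl⟩))))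
  have hat : β topPt ≤ a := hSa _ (Or.inl rfl)
  obtain ⟨f, hf0, hftop, x, hx, hfx⟩ := H a ha
  have hT0 : ∀ z, β z ≤ a → T f z = 0 := fun z hz =>
    hβf z f (fun w hw => hf0 w (hw.trans hz)) hftop
  have hTx : T f x ≠ 0 := norm_pos_iff.mp ((by positivity : (0:ℝ) ≤ δ * ‖f‖).trans_lt hfx)
  have hxtop : x < topPt := (le_topPt x).lt_of_ne (by rintro rfl; exact hTx (hT0 _ hat))
  -- `T f` is eventually equal to its value at `ω₁`, which is `0` since `β topPt ≤ a`. So any `y`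
  -- beyond `e (T f)` serves as the zero.
  obtain ⟨y, hy, hytop⟩ := exists_succ_lt_topPt (max_lt ha (he (T f)))
  have hTy : T f y = 0 := by
    rw [hef (T f) y ((le_max_right _ _).trans hy.le), hT0 _ hat]
  let t : Bump T δ⁻¹ :=
    { f := (T f x)⁻¹ • f
      a := a
      b := max (e f) (max x y)
      x := x
      y := y
      lt_topPt := max_lt (he f) (max_lt hxtop hytop)
      hx := ⟨hx, (le_max_left _ _).trans (le_max_right _ _)⟩
      hy := ⟨(le_max_left _ _).trans_lt hy, (le_max_right _ _).trans (le_max_right _ _)⟩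
      apply_of_le := fun z hz => by simp [hf0 z hz]
      apply_of_lt := fun z hz => by
        have : f z = 0 := by rw [hef f z ((le_max_left _ _).trans hz.le), hftop]
        simp [this]
      norm_le := by
        rw [norm_smul, norm_inv, inv_mul_le_iff₀ (norm_pos_iff.mpr hTx), ← div_eq_mul_inv,
          le_div_iff₀ hδ, mul_comm]
        exact hfx.le
      map_x := by simp [hTx]
      map_y := by simp [hTy]
      map_topPt := by simp [hT0 _ hat] }
  have hTt : ∀ z, β z ≤ a → T t.f z = 0 := fun z hz => by simp [t, hT0 z hz]
  -- The field `map_topPt` of the old bumps is needed here: it makes the eventual constant value of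
  -- `T s.f` zero.
  have hTs : ∀ s ∈ S, ∀ z, a < z → T s.f z = 0 := fun s hs z hz => by
    rw [hef (T s.f) z ((hae s hs).trans hz.le), s.map_topPt]
  refine ⟨t, fun ht => ?_, fun s hs => ⟨Or.inr (hab s hs), ⟨hTt _ (hax s hs), hTt _ (hay s hs)⟩,
    hTs s hs _ t.hx.1, hTs s hs _ t.hy.1⟩⟩
  exact (t.hx.1.trans_le t.hx.2).not_ge (hab t ht)

/-- The identity of `c₀(Γ)` factors through `T` if there is a family of pairwise independent bumps
indexed by `Γ`. -/
theorem exists_factor_id_of_indep {Γ : Type*} {T : COmegaOne 𝕜 →L[𝕜] COmegaOne 𝕜} {C : ℝ}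
    (hC : 0 ≤ C) (s : Γ → Bump T C) (hs : ∀ γ η, γ ≠ η → (s γ).Indep (s η)) :
    ∃ (U : COmegaOne 𝕜 →L[𝕜] cZero 𝕜 Γ) (V : cZero 𝕜 Γ →L[𝕜] COmegaOne 𝕜),
      ∀ c, U (T (V c)) = c := by
  obtain ⟨V, hV⟩ := exists_hasSum_of_disjoint (fun γ => (s γ).f) hC (fun γ => (s γ).norm_le)
    fun γ η hne x => by
      rcases (hs γ η hne).1 with h | h
      · rcases le_or_gt x (s η).a with hx | hx
        · exact Or.inr ((s η).apply_of_le x hx)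
        · exact Or.inl ((s γ).apply_of_lt x (h.trans_lt hx))
      · rcases le_or_gt x (s γ).a with hx | hx
        · exact Or.inl ((s γ).apply_of_le x hx)
        · exact Or.inr ((s η).apply_of_lt x (h.trans_lt hx))
  -- A single evaluation at `(s γ).x` would not map into `c₀(Γ)`, as constant functions show when
  -- `Γ` is infinite. The difference of two values inside the same interval does.
  let φ : Γ → COmegaOne 𝕜 →L[𝕜] 𝕜 := fun γ =>
    ContinuousMap.evalCLM 𝕜 (s γ).x - ContinuousMap.evalCLM 𝕜 (s γ).y
  have hφ : ∀ γ g, φ γ g = g (s γ).x - g (s γ).y := fun γ g => rfl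
  let U : COmegaOne 𝕜 →L[𝕜] cZero 𝕜 Γ := cZero.lift φ zero_le_two
    (fun γ g => by
      rw [hφ]
      have := norm_sub_le (g (s γ).x) (g (s γ).y)
      linarith [g.norm_coe_le_norm (s γ).x, g.norm_coe_le_norm (s γ).y])
    fun g ε hε => finite_le_norm_sub (fun γ => (s γ).hx) (fun γ => (s γ).hy)
      (fun γ η hne => (hs γ η hne).1) g hε
  refine ⟨U, V, fun c => cZero.ext_apply fun η => ?_⟩
  have h1 : HasSum (fun γ => ((φ η).comp T) (c.1 γ • (s γ).f)) (((φ η).comp T) (V c)) :=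
    (hV c).mapL _
  have h2 : HasSum (fun γ => ((φ η).comp T) (c.1 γ • (s γ).f))
      (((φ η).comp T) (c.1 η • (s η).f)) := by
    refine hasSum_single η fun γ hne => ?_
    have h3 := (hs γ η hne).2.1
    rw [ContinuousLinearMap.map_smul, ContinuousLinearMap.comp_apply, hφ, h3.1, h3.2, sub_zero,
      smul_zero]
  have h3 := h1.unique h2
  rw [ContinuousLinearMap.map_smul, ContinuousLinearMap.comp_apply, ContinuousLinearMap.comp_apply,
    hφ _ (T (s η).f), (s η).map_x, (s η).map_y, sub_zero, smul_eq_mul, mul_one] at h3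
  exact h3

/-- The identity of `c₀(ω₁)` factors through each operator that belongs to the ideal of some
`c₀(Γ)` but not to that of `c₀`. -/
theorem exists_factor_id_of_notMem {Γ : Type*} {T : COmegaOne 𝕜 →L[𝕜] COmegaOne 𝕜}
    (hT : T ∈ closedFactorOps 𝕜 (COmegaOne 𝕜) (COmegaOne 𝕜) (cZero 𝕜 Γ))
    (hT' : T ∉ closedFactorOps 𝕜 (COmegaOne 𝕜) (COmegaOne 𝕜) (cZero 𝕜 ℕ)) :
    ∃ (U : COmegaOne 𝕜 →L[𝕜] cZero 𝕜 CountableOrd) (V : cZero 𝕜 CountableOrd →L[𝕜] COmegaOne 𝕜),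
      ∀ c, U (T (V c)) = c := by
  obtain ⟨ε, hε, hball⟩ := Metric.isOpen_iff.mp
    (isClosed_closedFactorOps (𝕜 := 𝕜) (X := COmegaOne 𝕜) (Y := COmegaOne 𝕜)
      (Z := cZero 𝕜 ℕ)).isOpen_compl T hT'
  -- With `δ = ε / 4` the approximation error `2 * δ` is `ε / 2`, strictly inside the ball.
  have hδ : 0 < ε / 4 := by positivity
  obtain ⟨s, hs⟩ := exists_pairwise_family (r := Bump.Indep (T := T) (C := (ε / 4)⁻¹))
    (fun s t h => h.symm) fun S hS => exists_bump_indep hδ (fun a ha => by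
      by_contra! h
      obtain ⟨R, hR, hTR⟩ := exists_norm_sub_le hT ha hδ.le h
      refine hball ?_ hR
      rw [Metric.mem_ball, dist_comm, dist_eq_norm]
      linarith) hS
  exact exists_factor_id_of_indep (inv_nonneg.mpr hδ.le) s hs

/-- A closed ideal containing an operator through which the identity of `Z` factors contains the
closed ideal of operators factoring through `Z`. -/
theorem closedFactorIdeal_le_of_factor_id {X Z : Type*}
    [NormedAddCommGroup X] [NormedSpace 𝕜 X] [NormedAddCommGroup Z] [NormedSpace 𝕜 Z]
    {J : TwoSidedIdeal (BoundedOps 𝕜 X)} (hJ : IsClosed (J : Set (BoundedOps 𝕜 X)))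
    {T : X →L[𝕜] X} (hT : T ∈ J) (U : X →L[𝕜] Z) (V : Z →L[𝕜] X) (h : ∀ z, U (T (V z)) = z) :
    closedFactorIdeal 𝕜 X Z ≤ J := by
  -- A ring ideal of a unital algebra is stable under scalars, since `c • A = (c • 1) * A`. Hence
  -- `J` is a closed subspace, and checking operators of the form `B A` suffices.
  let M : Submodule 𝕜 (X →L[𝕜] X) :=
    { carrier := J
      add_mem' := fun hA hB => J.add_mem hA hB
      zero_mem' := J.zero_mem
      smul_mem' := fun c A hA => by
        have h1 : c • A = (c • (1 : BoundedOps 𝕜 X)) * A := by rw [smul_mul_assoc, one_mul]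
        rw [h1]
        exact J.mul_mem_left _ _ hA }
  have hM : closedFactorOps 𝕜 X X Z ≤ M := by
    refine Submodule.topologicalClosure_minimal _ (Submodule.span_le.mpr ?_) hJ
    rintro _ ⟨A, B, rfl⟩
    have h1 : B.comp A = (B.comp U) * T * (V.comp A) :=
      ContinuousLinearMap.ext fun f => congrArg B (h (A f)).symm
    rw [h1]
    exact J.mul_mem_right _ _ (J.mul_mem_left _ _ hT)
  intro R hR
  exact hM ((TwoSidedIdeal.mem_mk' ..).mp hR)

end Operators

theorem mainTheorem7 (𝕜 : Type*) [RCLike 𝕜] :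
    ¬ ∃ J : TwoSidedIdeal (BoundedOps 𝕜 (COmegaOne 𝕜)),
      IsClosed (J : Set (BoundedOps 𝕜 (COmegaOne 𝕜))) ∧
      closedFactorIdeal 𝕜 (COmegaOne 𝕜) (cZero 𝕜 ℕ) < J ∧
      J < closedFactorIdeal 𝕜 (COmegaOne 𝕜) (cZero 𝕜 CountableOrd) := by
  rintro ⟨J, hJ, h1, h2⟩
  obtain ⟨T, hTJ, hT⟩ := SetLike.exists_of_lt h1
  obtain ⟨U, V, hUV⟩ := exists_factor_id_of_notMem
    ((TwoSidedIdeal.mem_mk' ..).mp (h2.le hTJ)) fun h => hT ((TwoSidedIdeal.mem_mk' ..).mpr h)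
  exact h2.not_ge (closedFactorIdeal_le_of_factor_id hJ hTJ U V hUV)
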